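/- Let $G$ be a finitely generated infinite group that is virtually nilpotent (i.e. has a nilpotent subgroup of finite index). Then there exist a Banach metric $d$ on $G$ and a metric-functional $h \in \partial(G,d)$ whose orbit $G.h$ is finite. Here, for a metric $d$ on $G$, let $L(G,d)$ be the set of functions $h : G \to \mathbb{R}$ with $h(1)=0$ and $|h(x)-h(y)| \le d(x,y)$ for all $x,y \in G$, with the topology of pointwise convergence. For $x \in G$ let $b_x \in L(G,d)$ be $b_x(y) = d(x,y) - d(x,1)$. The metric-functional boundary is $$\partial(G,d) = \overline{\{b_x : x \in G\}} \setminus \{b_x : x \in G\},$$ with the closure taken in $L(G,d)$; its elements are called metric-functionals. The group $G$ acts on $L(G,d)$, when $d$ is left-invariant, by $(x.h)(y) = h(x^{-1}y) - h(x^{-1})$, and $G.h = \{x.h : x \in G\}$. A metric $d$ on $G$ is a Banach metric if 1. $d(x,y) \in \mathbb{N} = \{0,1,2,\dots\}$ for all $x,y \in G$; 2. $d(zx,zy) = d(x,y)$ for all $x,y,z \in G$; 3. for every $r>0$ the ball $\{x \in G : d(x,1) \le r\}$ is finite; 4. $(G,d)$ is quasi-isometric to a Cayley graph of $G$: there are a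 finite symmetric generating set $S$ of $G$, with graph distance $d_S$ on the Cayley graph ($x \sim y$ iff $x^{-1}y \in S$), a map $\varphi : G \to G$ and a constant $C>0$ such that every $y \in G$ satisfies $d_S(\varphi(x),y) \le C$ for some $x \in G$, and $C^{-1}d(x,x') - C \le d_S(\varphi(x),\varphi(x')) \le C\,d(x,x') + C$ for all $x,x' \in G$; 5. every $h \in \partial(G,d)$ is an unbounded function on $G$. -/

import Mathlib

/-- `d` is a metric on the set `X`. -/
structure IsMetric {X : Type*} (d : X → X → ℝ) : Prop where
  eq_zero_iff : ∀ x y, d x y = 0 ↔ x = y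
  symm : ∀ x y, d x y = d y x
  triangle : ∀ x y z, d x z ≤ d x y + d y z

/-- The set `L(X, d)` of functions that are 1-Lipschitz for `d` and vanish at the base point. -/
def lipschitzFunctionals {X : Type*} (d : X → X → ℝ) (x₀ : X) : Set (X → ℝ) :=
  {h | (∀ x y, |h x - h y| ≤ d x y) ∧ h x₀ = 0}

/-- The Busemann function `b_x(y) = d(x, y) - d(x, x₀)`. -/
def busemann {X : Type*} (d : X → X → ℝ) (x₀ x : X) : X → ℝ :=
  fun y => d x y - d x x₀

/-- The closure of the Busemann functions in `L(X, d)`, for the topology of pointwise convergence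
(the product topology on `X → ℝ`, restricted to `L(X, d)`). -/
def metricCompactification {X : Type*} (d : X → X → ℝ) (x₀ : X) : Set (X → ℝ) :=
  lipschitzFunctionals d x₀ ∩ closure (Set.range (busemann d x₀))

/-- The metric-functional boundary `∂(X, d)`; its elements are the metric-functionals. -/
def metricBoundary {X : Type*} (d : X → X → ℝ) (x₀ : X) : Set (X → ℝ) :=
  metricCompactification d x₀ \ Set.range (busemann d x₀)

/-- `S` is a finite symmetric generating set of the group `G`. -/
structure IsFiniteSymmGenSet {G : Type*} [Group G] (S : Set G) : Prop where
  finite : S.Finite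
  inv_mem : ∀ s ∈ S, s⁻¹ ∈ S
  closure_eq_top : Subgroup.closure S = ⊤

/-- The graph distance of the (right) Cayley graph of `G` with respect to `S`, in which
`x ∼ y` iff `x⁻¹ * y ∈ S`, for symmetric `S` and `x ≠ y`. -/
noncomputable def cayleyDist {G : Type*} [Group G] (S : Set G) (x y : G) : ℝ :=
  ((SimpleGraph.mulCayley S).dist x y : ℝ)

/-- `φ` is a quasi-isometry from `(X, d)` to `(Y, ρ)`. -/
def IsQuasiIsometry {X Y : Type*} (d : X → X → ℝ) (ρ : Y → Y → ℝ) (φ : X → Y) : Prop :=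
  ∃ C : ℝ, 0 < C ∧ (∀ y, ∃ x, ρ (φ x) y ≤ C) ∧
    ∀ x x', C⁻¹ * d x x' - C ≤ ρ (φ x) (φ x') ∧ ρ (φ x) (φ x') ≤ C * d x x' + C

/-- `d` is a Banach metric on `G` (for `G` an infinite finitely generated group). The base point
is the identity. -/
structure IsBanachMetric {G : Type*} [Group G] (d : G → G → ℝ) : Prop where
  isMetric : IsMetric d
  integer_valued : ∀ x y, ∃ n : ℕ, d x y = n
  left_invariant : ∀ x y z, d (z * x) (z * y) = d x y
  proper : ∀ r : ℝ, 0 < r → {x : G | d x 1 ≤ r}.Finite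
  group_geometry : ∃ S : Set G, IsFiniteSymmGenSet S ∧
    ∃ φ : G → G, IsQuasiIsometry d (cayleyDist S) φ
  unbounded : ∀ h ∈ metricBoundary d 1, ¬ ∃ C : ℝ, ∀ x, |h x| ≤ C

/-- The action of `G` on functions: `(x.h)(y) = h(x⁻¹ y) - h(x⁻¹)`. -/
def functionalAct {G : Type*} [Group G] (x : G) (h : G → ℝ) : G → ℝ :=
  fun y => h (x⁻¹ * y) - h x⁻¹

/-- The orbit `G.h` of `h` under the action above. -/
def functionalOrbit {G : Type*} [Group G] (h : G → ℝ) : Set (G → ℝ) :=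
  Set.range fun x : G => functionalAct x h

/-- `G` has a nilpotent subgroup of finite index. -/
def IsVirtuallyNilpotent (G : Type*) [Group G] : Prop :=
  ∃ H : Subgroup G, H.FiniteIndex ∧ Group.IsNilpotent H

/-!
A virtually nilpotent infinite finitely generated group `G` has a normal subgroup `N` of finite
index with a nonzero homomorphism `φ : N → ℤ` (`exists_normal_hom_int_ne_one`). Extending `φ` to
`G` and taking translates gives a finite family `F` of functions `G → ℤ`, invariant under negation
and under the action of `G`, each fixed by `N` and a nonzero homomorphism on `N`
(`exists_isInvariantFamily`). Hence `D(x, y) = max_{f ∈ F} |f x - f y|` is a left-invariant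
pseudometric, Lipschitz for the word metric `d_S`, and the required metric is
`d = max (M D, d_S)` for a large integer `M`.

All metric-functionals of `d` are unbounded (`unbounded_of_mem_metricBoundary_mixedDist`): they
inherit arbitrarily negative values from the geodesics of `d_S`, or arbitrarily large ones from
the members of `F`.

To find a finite orbit, take `t ∈ N` at which any two members of `F` that differ on `N` differ, and
`M` so large that `M D(1, tⁿ)` outgrows `d_S(1, tⁿ)`. Then the Busemann functions of `tⁿ` converge
to `h = -M min_{f ∈ A} f`, where `A ⊆ F` consists of the members with maximal value at `t`
(`IsInvariantFamily.exists_eventually_eq`). By the choice of `t` all of `A` agrees on `N`, so `N`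
fixes `h`, and the orbit of `h` is finite.
-/

/-! ### Homomorphisms to the integers -/

theorem exists_hom_int_ne_one_of_commGroup (A : Type*) [CommGroup A] [Group.FG A] [Infinite A] :
    ∃ φ : A →* Multiplicative ℤ, φ ≠ 1 := by
  obtain ⟨ι, j, _, _, p, hp, e, ⟨E⟩⟩ := CommGroup.equiv_free_prod_prod_multiplicative_zmod A
  have : ∀ i, NeZero (p i ^ e i) := fun i => ⟨pow_ne_zero _ (hp i).ne_zero⟩
  have : ∀ i, Finite (Multiplicative (ZMod (p i ^ e i))) := fun i =>
    inferInstanceAs (Finite (ZMod (p i ^ e i)))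
  rcases isEmpty_or_nonempty j with hj | ⟨⟨k⟩⟩
  · exact absurd (Finite.of_equiv _ E.symm.toEquiv) (not_finite_iff_infinite.mpr inferInstance)
  · refine ⟨((Pi.evalMonoidHom _ k).comp (MonoidHom.fst _ _)).comp E.toMonoidHom, fun h => ?_⟩
    have := DFunLike.congr_fun h (E.symm (fun _ => Multiplicative.ofAdd 1, 1))
    simp at this

/-- An infinite finitely generated nilpotent group maps nontrivially to `ℤ`. Inductively, either
`G / Z(G)` is infinite, or `Z(G)` has finite index and the transfer to the centre
`g ↦ g ^ [G : Z(G)]` reduces the claim to the abelian case. -/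
theorem exists_hom_int_ne_one_of_nilpotent (G : Type*) [Group G] [Group.IsNilpotent G]
    (hfg : Group.FG G) (hinf : Infinite G) : ∃ φ : G →* Multiplicative ℤ, φ ≠ 1 := by
  revert hfg hinf
  refine Group.nilpotent_center_quotient_ind
    (P := fun G _ _ => Group.FG G → Infinite G → ∃ φ : G →* Multiplicative ℤ, φ ≠ 1) G ?_ ?_
  · intro G _ _ _ hinf
    exact absurd hinf (not_infinite_iff_finite.mpr inferInstance)
  · intro G _ _ ih hfg hinf
    rcases finite_or_infinite (G ⧸ Subgroup.center G) with hfin | hq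
    · have : (Subgroup.center G).FiniteIndex := Subgroup.finiteIndex_of_finite_quotient
      have : Infinite (Subgroup.center G) := by
        by_contra hc
        rw [not_infinite_iff_finite] at hc
        exact absurd (Finite.of_equiv _ (Subgroup.groupEquivQuotientProdSubgroup
          (s := Subgroup.center G)).symm) (not_finite_iff_infinite.mpr hinf)
      let _ : CommGroup (Subgroup.center G) :=
        { (inferInstance : Group (Subgroup.center G)) with
          mul_comm := fun a b => Subtype.ext (Subgroup.mem_center_iff.1 b.2 a) }
      obtain ⟨ψ, hψ⟩ := exists_hom_int_ne_one_of_commGroup (Subgroup.center G)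
      obtain ⟨z, hz⟩ : ∃ z, ψ z ≠ 1 := by
        by_contra! h
        exact hψ (MonoidHom.ext h)
      refine ⟨ψ.comp (MonoidHom.transferCenterPow G), fun h => hz ?_⟩
      have hz' : MonoidHom.transferCenterPow G (z : G) = z ^ (Subgroup.center G).index :=
        Subtype.ext (by simp [MonoidHom.transferCenterPow_apply])
      have := DFunLike.congr_fun h (z : G)
      rw [MonoidHom.comp_apply, hz', map_pow, MonoidHom.one_apply] at this
      exact (pow_eq_one_iff_left Subgroup.FiniteIndex.index_ne_zero).mp this
    · obtain ⟨φ, hφ⟩ := ih inferInstance hq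
      refine ⟨φ.comp (QuotientGroup.mk' _), fun h => hφ ?_⟩
      refine MonoidHom.ext fun x => ?_
      obtain ⟨g, rfl⟩ := QuotientGroup.mk'_surjective _ x
      simpa using DFunLike.congr_fun h g

theorem exists_normal_hom_int_ne_one {G : Type*} [Group G] [Group.FG G] [Infinite G]
    (hG : IsVirtuallyNilpotent G) :
    ∃ N : Subgroup G, N.Normal ∧ N.FiniteIndex ∧ ∃ φ : N →* Multiplicative ℤ, φ ≠ 1 := by
  obtain ⟨H, hH, hnil⟩ := hG
  have hN : Group.IsNilpotent H.normalCore :=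
    Group.nilpotent_of_mulEquiv (Subgroup.subgroupOfEquivOfLe H.normalCore_le)
  have : Infinite H.normalCore := by
    by_contra hc
    rw [not_infinite_iff_finite] at hc
    have : Finite (G ⧸ H.normalCore) := inferInstance
    exact absurd (Finite.of_equiv _ (Subgroup.groupEquivQuotientProdSubgroup
      (s := H.normalCore)).symm) (not_finite_iff_infinite.mpr inferInstance)
  exact ⟨H.normalCore, inferInstance, inferInstance,
    exists_hom_int_ne_one_of_nilpotent _ inferInstance inferInstance⟩

/-! ### Cayley graphs -/

section Cayley

variable {G : Type*} [Group G] {S : Set G}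

theorem mulCayley_connected (hS : Subgroup.closure S = ⊤) : (SimpleGraph.mulCayley S).Connected := by
  have hstep : ∀ x : G, ∀ s ∈ S, (SimpleGraph.mulCayley S).Reachable x (x * s) := by
    intro x s hs
    by_cases h : x = x * s
    · rw [← h]
    · exact SimpleGraph.Adj.reachable
        ((SimpleGraph.mulCayley_adj' S _ _).2 ⟨h, s, hs, Or.inl rfl⟩)
  have hall : ∀ g x : G, (SimpleGraph.mulCayley S).Reachable x (x * g) := by
    intro g
    have hg : g ∈ Subgroup.closure S := hS ▸ Subgroup.mem_top g
    induction hg using Subgroup.closure_induction with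
    | mem s hs => exact fun x => hstep x s hs
    | one => simp
    | mul a b _ _ ha hb => intro x; rw [← mul_assoc]; exact (ha x).trans (hb _)
    | inv a _ ha => intro x; simpa using (ha (x * a⁻¹)).symm
  have : Nonempty G := ⟨1⟩
  exact ⟨fun x y => by simpa using hall (x⁻¹ * y) x⟩

theorem mulCayley_dist_mul_left (hS : Subgroup.closure S = ⊤) (z x y : G) :
    (SimpleGraph.mulCayley S).dist (z * x) (z * y) = (SimpleGraph.mulCayley S).dist x y := by
  have key : ∀ z x y : G,
      (SimpleGraph.mulCayley S).dist (z * x) (z * y) ≤ (SimpleGraph.mulCayley S).dist x y := by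
    intro z x y
    obtain ⟨p, hp⟩ := (mulCayley_connected hS).exists_walk_length_eq_dist x y
    let f : SimpleGraph.mulCayley S →g SimpleGraph.mulCayley S :=
      ⟨fun a => z * a, fun h => SimpleGraph.mulCayley_adj_mul_iff_right.2 h⟩
    rw [← hp, ← SimpleGraph.Walk.length_map f p]
    exact SimpleGraph.dist_le _
  refine le_antisymm (key z x y) ?_
  simpa using key z⁻¹ (z * x) (z * y)

/-- Along a geodesic between two points there is a point at each intermediate distance. -/
theorem exists_dist_eq_and_dist_add_eq {V : Type*} {Γ : SimpleGraph V} (hΓ : Γ.Connected) {u v : V}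
    {k : ℕ} (hk : k ≤ Γ.dist u v) : ∃ w, Γ.dist u w = k ∧ k + Γ.dist w v = Γ.dist u v := by
  obtain ⟨p, hp⟩ := hΓ.exists_walk_length_eq_dist u v
  have h1 := SimpleGraph.dist_le (p.take k)
  have h2 := SimpleGraph.dist_le (p.drop k)
  have h3 : Γ.dist u v ≤ Γ.dist u (p.getVert k) + Γ.dist (p.getVert k) v := hΓ.dist_triangle
  rw [SimpleGraph.Walk.take_length] at h1
  rw [SimpleGraph.Walk.drop_length] at h2
  exact ⟨p.getVert k, by omega, by omega⟩

theorem finite_setOf_mulCayley_dist_le (hS : S.Finite) (hgen : Subgroup.closure S = ⊤) (n : ℕ) :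
    {x : G | (SimpleGraph.mulCayley S).dist 1 x ≤ n}.Finite := by
  have hconn := mulCayley_connected hgen
  induction n with
  | zero =>
    refine (Set.finite_singleton (1 : G)).subset fun x hx => ?_
    exact (hconn.dist_eq_zero_iff.1 (Nat.le_zero.1 hx)).symm
  | succ n ih =>
    refine (ih.union (ih.mul (hS.union hS.inv))).subset fun x hx => ?_
    rcases Nat.lt_or_ge n ((SimpleGraph.mulCayley S).dist 1 x) with h | h
    · right
      obtain ⟨w, hw, hwx⟩ := exists_dist_eq_and_dist_add_eq hconn h.le
      have hadj : (SimpleGraph.mulCayley S).Adj w x :=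
        SimpleGraph.dist_eq_one_iff_adj.1 (by have : _ ≤ n + 1 := hx; omega)
      refine ⟨w, hw.le, w⁻¹ * x, ?_, by simp⟩
      rcases ((SimpleGraph.mulCayley_adj S w x).1 hadj).2 with h | h
      · exact Or.inl h
      · right; simpa using h
    · exact Or.inl h

/-- A left-invariant pseudometric is Lipschitz for the word metric. -/
theorem exists_le_mul_mulCayley_dist (hS : S.Finite) (hgen : Subgroup.closure S = ⊤)
    (D : G → G → ℕ) (hself : ∀ x, D x x = 0) (hsymm : ∀ x y, D x y = D y x)
    (htri : ∀ x y z, D x z ≤ D x y + D y z) (hinv : ∀ z x y, D (z * x) (z * y) = D x y) :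
    ∃ L : ℕ, ∀ x y, D x y ≤ L * (SimpleGraph.mulCayley S).dist x y := by
  refine ⟨hS.toFinset.sup (D 1), fun x y => ?_⟩
  set L := hS.toFinset.sup (D 1)
  have hL : ∀ s ∈ S, D 1 s ≤ L := fun s hs =>
    Finset.le_sup (f := D 1) (hS.mem_toFinset.2 hs)
  have hadj : ∀ u v, (SimpleGraph.mulCayley S).Adj u v → D u v ≤ L := by
    intro u v h
    rcases ((SimpleGraph.mulCayley_adj S u v).1 h).2 with h | h
    · have := hinv u 1 (u⁻¹ * v)
      simp only [mul_one, mul_inv_cancel_left] at this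
      exact this ▸ hL _ h
    · have := hinv v 1 (v⁻¹ * u)
      simp only [mul_one, mul_inv_cancel_left] at this
      rw [hsymm]
      exact this ▸ hL _ h
  obtain ⟨p, hp⟩ := (mulCayley_connected hgen).exists_walk_length_eq_dist x y
  rw [← hp]
  clear hp
  induction p with
  | nil => simp [hself]
  | cons h p ih =>
    rw [SimpleGraph.Walk.length_cons, mul_add, mul_one, add_comm]
    exact (htri _ _ _).trans (add_le_add (hadj _ _ h) ih)

theorem exists_isFiniteSymmGenSet (G : Type*) [Group G] [Group.FG G] :
    ∃ S : Set G, IsFiniteSymmGenSet S := by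
  obtain ⟨T, hT⟩ := Group.FG.out (G := G)
  refine ⟨T ∪ (T : Set G)⁻¹, T.finite_toSet.union T.finite_toSet.inv, ?_, ?_⟩
  · rintro s (hs | hs)
    · right; simpa using hs
    · left; simpa using hs
  · exact top_le_iff.1 (hT ▸ Subgroup.closure_mono Set.subset_union_left)

end Cayley

/-! ### Invariant families of integer-valued functions -/

section Pseudometric

variable {X : Type*}

/-- The pseudometric `max_{f ∈ F} |f x - f y|` on `X`. -/
def familyDist (F : Finset (X → ℤ)) (x y : X) : ℕ :=
  F.sup fun f => (f x - f y).natAbs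

theorem familyDist_self (F : Finset (X → ℤ)) (x : X) : familyDist F x x = 0 := by
  simp [familyDist]

theorem familyDist_comm (F : Finset (X → ℤ)) (x y : X) : familyDist F x y = familyDist F y x := by
  exact Finset.sup_congr rfl fun f _ => by rw [← Int.natAbs_neg, neg_sub]

theorem natAbs_sub_le_familyDist {F : Finset (X → ℤ)} {f : X → ℤ} (hf : f ∈ F) (x y : X) :
    (f x - f y).natAbs ≤ familyDist F x y :=
  Finset.le_sup (f := fun f : X → ℤ => (f x - f y).natAbs) hf

theorem sub_le_familyDist {F : Finset (X → ℤ)} {f : X → ℤ} (hf : f ∈ F) (x y : X) :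
    f x - f y ≤ familyDist F x y := by
  have := natAbs_sub_le_familyDist hf x y
  omega

theorem familyDist_triangle (F : Finset (X → ℤ)) (x y z : X) :
    familyDist F x z ≤ familyDist F x y + familyDist F y z := by
  refine Finset.sup_le fun f hf => ?_
  have h1 := natAbs_sub_le_familyDist hf x y
  have h2 := natAbs_sub_le_familyDist hf y z
  omega

end Pseudometric

section Family

variable {G : Type*} [Group G]

/-- A finite family of integer-valued functions on `G`, symmetric under negation and invariant under
the action `(z.f)(y) = f(z⁻¹ y) - f(z⁻¹)` (stated here with `z` for `z⁻¹`), each of whose members is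
fixed by the subgroup `N` and restricts to a nonzero homomorphism on `N`. -/
structure IsInvariantFamily (N : Subgroup G) (F : Finset (G → ℤ)) : Prop where
  nonempty : F.Nonempty
  neg_mem : ∀ f ∈ F, -f ∈ F
  translate_mem : ∀ f ∈ F, ∀ z, (fun y => f (z * y) - f z) ∈ F
  map_mul : ∀ f ∈ F, ∀ n ∈ N, ∀ y, f (n * y) = f n + f y
  exists_ne_zero : ∀ f ∈ F, ∃ n ∈ N, f n ≠ 0

/-- A nonzero homomorphism `φ : N → ℤ` on a normal subgroup of finite index extends to a function
`h₀` on `G` with `h₀(n y) = φ(n) + h₀(y)`; its translates depend only on a class modulo `N`, so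
that together with their negatives they form an invariant family. -/
theorem exists_isInvariantFamily (N : Subgroup G) [N.Normal] [N.FiniteIndex]
    (φ : N →* Multiplicative ℤ) (hφ : φ ≠ 1) : ∃ F, IsInvariantFamily N F := by
  classical
  obtain ⟨m, hm⟩ : ∃ m, φ m ≠ 1 := by
    by_contra! h
    exact hφ (MonoidHom.ext h)
  have hrep : ∀ y : G, y * ((y : G ⧸ N).out)⁻¹ ∈ N := fun y => by
    have h : (((y : G ⧸ N).out : G) : G ⧸ N) = y := Quotient.out_eq' _
    rw [← QuotientGroup.eq_one_iff]
    simp [h]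
  let h₀ : G → ℤ := fun y => (φ ⟨_, hrep y⟩).toAdd
  have h₀mul : ∀ (n : N) y, h₀ (n * y) = (φ n).toAdd + h₀ y := fun n y => by
    have hq : ((n * y : G) : G ⧸ N) = y := by
      simp [(QuotientGroup.eq_one_iff (n : G)).2 n.2]
    have : (⟨_, hrep (n * y)⟩ : N) = n * ⟨_, hrep y⟩ := by
      ext
      simp [hq, mul_assoc]
    change (φ ⟨_, hrep (n * y)⟩).toAdd = _
    rw [this, _root_.map_mul, toAdd_mul]
  let f : G → G → ℤ := fun z y => h₀ (z * y) - h₀ z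
  let conj : G → N → N := fun z n => ⟨z * n * z⁻¹, ‹N.Normal›.conj_mem n n.2 z⟩
  have fN : ∀ z (n : N) y, f z (n * y) = (φ (conj z n)).toAdd + f z y := fun z n y => by
    have : z * (n * y) = (conj z n : N) * (z * y) := by simp [conj, mul_assoc]
    simp only [f, this, h₀mul]
    ring
  have f1 : ∀ z, f z 1 = 0 := fun z => by simp [f]
  have fN' : ∀ z (n : N), f z n = (φ (conj z n)).toAdd := fun z n => by
    simpa [f1] using fN z n 1
  have fmul : ∀ z w y, f z (w * y) - f z w = f (z * w) y := fun z w y => by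
    simp [f, mul_assoc]
  have fne : ∀ z, f z ((conj z⁻¹ m : N) : G) ≠ 0 := fun z => by
    have : conj z (conj z⁻¹ m) = m := by ext; simp [conj, mul_assoc]
    rw [fN', this]
    exact fun h => hm (Multiplicative.toAdd.injective h)
  have ffin : (Set.range f).Finite := by
    refine (Set.finite_range fun q : G ⧸ N => f q.out).subset ?_
    rintro _ ⟨z, rfl⟩
    refine ⟨z, ?_⟩
    ext y
    have hz : z = ((⟨_, hrep z⟩ : N) : G) * (z : G ⧸ N).out := by simp
    have finv : ∀ (n : N) w, f (n * w) y = f w y := fun n w => by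
      simp only [f, mul_assoc, h₀mul]
      ring
    conv_rhs => rw [hz]
    rw [finv]
  have hmem : ∀ g, g ∈ ffin.toFinset ∪ ffin.toFinset.image Neg.neg ↔
      ∃ z, g = f z ∨ g = -f z := fun g => by
    rw [exists_or]
    simp only [Finset.mem_union, Set.Finite.mem_toFinset, Set.mem_range, Finset.mem_image,
      exists_exists_eq_and]
    simp only [eq_comm]
  refine ⟨ffin.toFinset ∪ ffin.toFinset.image Neg.neg, ⟨f 1, (hmem _).2 ⟨1, Or.inl rfl⟩⟩,
    ?_, ?_, ?_, ?_⟩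
  · intro g hg
    obtain ⟨z, rfl | rfl⟩ := (hmem g).1 hg
    · exact (hmem _).2 ⟨z, Or.inr rfl⟩
    · exact (hmem _).2 ⟨z, Or.inl (neg_neg _)⟩
  · intro g hg w
    obtain ⟨z, rfl | rfl⟩ := (hmem g).1 hg
    · exact (hmem _).2 ⟨z * w, Or.inl (funext fun y => fmul z w y)⟩
    · refine (hmem _).2 ⟨z * w, Or.inr (funext fun y => ?_)⟩
      simp only [Pi.neg_apply, ← fmul z w y]
      ring
  · intro g hg n hn y
    obtain ⟨z, rfl | rfl⟩ := (hmem g).1 hg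
    · rw [fN z ⟨n, hn⟩ y, fN' z ⟨n, hn⟩]
    · simp only [Pi.neg_apply, fN z ⟨n, hn⟩ y, fN' z ⟨n, hn⟩]
      ring
  · intro g hg
    obtain ⟨z, rfl | rfl⟩ := (hmem g).1 hg
    · exact ⟨_, (conj z⁻¹ m).2, fne z⟩
    · exact ⟨_, (conj z⁻¹ m).2, neg_ne_zero.2 (fne z)⟩

theorem map_pow_of_map_mul {N : Subgroup G} {f : G → ℤ}
    (hf : ∀ m ∈ N, ∀ n ∈ N, f (m * n) = f m + f n) {n : G} (hn : n ∈ N) (k : ℕ) :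
    f (n ^ k) = k * f n := by
  induction k with
  | zero => simpa using hf 1 N.one_mem 1 N.one_mem
  | succ k ih => rw [pow_succ, hf _ (N.pow_mem hn k) _ hn, ih]; push_cast; ring

/-- Finitely many nonzero homomorphisms to `ℤ` have a common point outside all their kernels. -/
theorem exists_forall_ne_zero {N : Subgroup G} (P : Finset (G → ℤ))
    (hP : ∀ f ∈ P, ∀ m ∈ N, ∀ n ∈ N, f (m * n) = f m + f n)
    (hne : ∀ f ∈ P, ∃ n ∈ N, f n ≠ 0) : ∃ t ∈ N, ∀ f ∈ P, f t ≠ 0 := by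
  classical
  induction P using Finset.induction_on with
  | empty => exact ⟨1, N.one_mem, by simp⟩
  | insert ψ P _ ih =>
    simp only [Finset.forall_mem_insert] at hP hne ⊢
    obtain ⟨t, ht, hPt⟩ := ih hP.2 hne.2
    obtain ⟨s, hs, hψs⟩ := hne.1
    by_cases hψt : ψ t = 0
    · -- `ψ` does not see powers of `t`, and for a large power `t ^ k` outweighs `s` in `P`.
      set k : ℕ := 1 + ∑ f ∈ P, (f s).natAbs
      refine ⟨t ^ k * s, N.mul_mem (N.pow_mem ht k) hs, ?_, fun f hf => ?_⟩
      · rw [hP.1 _ (N.pow_mem ht k) _ hs, map_pow_of_map_mul hP.1 ht, hψt]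
        simpa using hψs
      · rw [hP.2 f hf _ (N.pow_mem ht k) _ hs, map_pow_of_map_mul (hP.2 f hf) ht]
        intro h0
        have h1 : (f s).natAbs < k := by
          have := Finset.single_le_sum (f := fun f : G → ℤ => (f s).natAbs)
            (fun _ _ => Nat.zero_le _) hf
          simp only [k] at this ⊢
          omega
        have h2 : (f s).natAbs = k * (f t).natAbs := by
          rw [eq_neg_of_add_eq_zero_right h0, Int.natAbs_neg, Int.natAbs_mul, Int.natAbs_natCast]
        have h3 : 1 ≤ (f t).natAbs := Int.natAbs_pos.2 (hPt f hf)
        nlinarith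
    · exact ⟨t, ht, hψt, hPt⟩

namespace IsInvariantFamily

variable {N : Subgroup G} {F : Finset (G → ℤ)}

theorem map_one (hF : IsInvariantFamily N F) {f : G → ℤ} (hf : f ∈ F) : f 1 = 0 := by
  simpa using hF.map_mul f hf 1 N.one_mem 1

theorem map_pow (hF : IsInvariantFamily N F) {f : G → ℤ} (hf : f ∈ F) {n : G} (hn : n ∈ N)
    (k : ℕ) : f (n ^ k) = k * f n :=
  map_pow_of_map_mul (fun m hm n _ => hF.map_mul f hf m hm n) hn k

theorem map_inv (hF : IsInvariantFamily N F) {f : G → ℤ} (hf : f ∈ F) {n : G} (hn : n ∈ N) :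
    f n⁻¹ = -f n := by
  have := hF.map_mul f hf n hn n⁻¹
  rw [mul_inv_cancel, hF.map_one hf] at this
  linarith

/-- There is a point of `N` at which members of the family with distinct restrictions to `N` take
distinct values. -/
theorem exists_generic (hF : IsInvariantFamily N F) :
    ∃ t ∈ N, ∀ f ∈ F, ∀ g ∈ F, f t = g t → ∀ n ∈ N, f n = g n := by
  classical
  let P : Finset (G → ℤ) :=
    ((F ×ˢ F).image fun p => p.1 - p.2).filter fun f => ∃ n ∈ N, f n ≠ 0
  have hP : ∀ f ∈ P, ∀ m ∈ N, ∀ n ∈ N, f (m * n) = f m + f n := by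
    intro f hf m hm n _
    obtain ⟨⟨a, b⟩, hab, rfl⟩ := Finset.mem_image.1 (Finset.mem_filter.1 hf).1
    obtain ⟨ha, hb⟩ := Finset.mem_product.1 hab
    simp only [Pi.sub_apply, hF.map_mul a ha m hm n, hF.map_mul b hb m hm n]
    ring
  obtain ⟨t, ht, h⟩ := exists_forall_ne_zero P hP fun f hf => (Finset.mem_filter.1 hf).2
  refine ⟨t, ht, fun f hf g hg hfg => ?_⟩
  by_contra! hn
  obtain ⟨n, hn, hne⟩ := hn
  refine h (f - g) (Finset.mem_filter.2 ⟨Finset.mem_image.2 ⟨(f, g), ?_, rfl⟩, n, hn, ?_⟩) ?_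
  · exact Finset.mem_product.2 ⟨hf, hg⟩
  · exact sub_ne_zero.2 hne
  · exact sub_eq_zero.2 hfg

theorem ne_zero_of_generic (hF : IsInvariantFamily N F) {t : G}
    (hgen : ∀ f ∈ F, ∀ g ∈ F, f t = g t → ∀ n ∈ N, f n = g n) {f : G → ℤ} (hf : f ∈ F) :
    f t ≠ 0 := by
  intro h0
  obtain ⟨n, hn, hne⟩ := hF.exists_ne_zero f hf
  have := hgen f hf (-f) (hF.neg_mem f hf) (by simp [h0]) n hn
  simp only [Pi.neg_apply] at this
  omega

end IsInvariantFamily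

namespace IsInvariantFamily

variable {N : Subgroup G} {F : Finset (G → ℤ)}

theorem familyDist_mul_left (hF : IsInvariantFamily N F) (z x y : G) :
    familyDist F (z * x) (z * y) = familyDist F x y := by
  have key : ∀ z x y : G, familyDist F (z * x) (z * y) ≤ familyDist F x y := by
    refine fun z x y => Finset.sup_le fun f hf => ?_
    have := natAbs_sub_le_familyDist (hF.translate_mem f hf z) x y
    simpa using this
  refine le_antisymm (key z x y) ?_
  simpa using key z⁻¹ (z * x) (z * y)

theorem exists_familyDist_eq (hF : IsInvariantFamily N F) (x y : G) :
    ∃ f ∈ F, (familyDist F x y : ℤ) = f x - f y := by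
  obtain ⟨f, hf, h⟩ := Finset.exists_mem_eq_sup F hF.nonempty fun f => (f x - f y).natAbs
  have h' : familyDist F x y = (f x - f y).natAbs := h
  rcases le_total 0 (f x - f y) with h0 | h0
  · exact ⟨f, hf, by omega⟩
  · refine ⟨-f, hF.neg_mem f hf, ?_⟩
    simp only [Pi.neg_apply]
    omega

end IsInvariantFamily

end Family

/-! ### Metric-functionals -/

section MetricFunctionals

open Filter Topology

/-- A boundary point is approximated on finite sets by Busemann functions whose base points avoid
a given finite set, since it is itself not a Busemann function. -/
theorem exists_notMem_busemann_close {X : Type*} {d : X → X → ℝ} {x₀ : X} {h : X → ℝ}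
    (hh : h ∈ metricBoundary d x₀) {E K : Set X} (hE : E.Finite) (hK : K.Finite) :
    ∃ x ∉ E, ∀ y ∈ K, |busemann d x₀ x y - h y| < 1 := by
  obtain ⟨⟨-, hcl⟩, hnot⟩ := hh
  rw [← Set.image_univ, ← Set.union_compl_self E, Set.image_union, closure_union,
    (hE.image _).isClosed.closure_eq] at hcl
  rcases hcl with hcl | hcl
  · exact absurd (Set.image_subset_range _ _ hcl) hnot
  · have hU : K.pi (fun y => Metric.ball (h y) 1) ∈ 𝓝 h :=
      set_pi_mem_nhds hK fun y _ => Metric.ball_mem_nhds _ one_pos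
    obtain ⟨_, hb, x, hx, rfl⟩ := mem_closure_iff_nhds.1 hcl _ hU
    exact ⟨x, hx, fun y hy => by simpa [Real.dist_eq] using hb y hy⟩

theorem busemann_mem_lipschitzFunctionals {X : Type*} {d : X → X → ℝ} (hd : IsMetric d)
    (x₀ x : X) : busemann d x₀ x ∈ lipschitzFunctionals d x₀ := by
  refine ⟨fun y z => ?_, by simp [busemann]⟩
  have h1 := hd.triangle x y z
  have h2 := hd.triangle x z y
  rw [hd.symm z y] at h2
  simp only [busemann]
  rw [abs_le]
  constructor <;> linarith

/-- Pointwise limits of Busemann functions that are not bounded below lie on the boundary, because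
Busemann functions are bounded below. -/
theorem mem_metricBoundary_of_eventually_eq {X : Type*} {d : X → X → ℝ} (hd : IsMetric d)
    (hnonneg : ∀ x y, 0 ≤ d x y) {x₀ : X} {u : ℕ → X} {h : X → ℝ}
    (hu : ∀ y, ∀ᶠ n in atTop, busemann d x₀ (u n) y = h y) (hbdd : ∀ C : ℝ, ∃ y, h y < C) :
    h ∈ metricBoundary d x₀ := by
  refine ⟨⟨⟨fun y z => ?_, ?_⟩, ?_⟩, ?_⟩
  · obtain ⟨n, hy, hz⟩ := ((hu y).and (hu z)).exists
    rw [← hy, ← hz]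
    exact (busemann_mem_lipschitzFunctionals hd x₀ (u n)).1 y z
  · obtain ⟨n, hn⟩ := (hu x₀).exists
    rw [← hn]
    exact (busemann_mem_lipschitzFunctionals hd x₀ (u n)).2
  · exact mem_closure_of_tendsto (f := fun n => busemann d x₀ (u n))
      (tendsto_pi_nhds.2 fun y => tendsto_nhds_of_eventually_eq (hu y))
      (Eventually.of_forall fun n => Set.mem_range_self _)
  · rintro ⟨x, rfl⟩
    obtain ⟨y, hy⟩ := hbdd (-d x x₀)
    have := hnonneg x y
    simp only [busemann] at hy
    linarith

theorem finite_functionalOrbit {G : Type*} [Group G] (N : Subgroup G) [N.FiniteIndex]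
    {h : G → ℝ} (hN : ∀ n ∈ N, ∀ y, h (n * y) = h n + h y) : (functionalOrbit h).Finite := by
  refine (Set.finite_range fun q : G ⧸ N => functionalAct q.out h).subset ?_
  rintro _ ⟨x, rfl⟩
  refine ⟨x, funext fun y => ?_⟩
  have hq : ((x : G ⧸ N).out)⁻¹ * x ∈ N := QuotientGroup.eq.1 (Quotient.out_eq' _)
  have h1 : ∀ y, ((x : G ⧸ N).out)⁻¹ * y = (((x : G ⧸ N).out)⁻¹ * x) * (x⁻¹ * y) :=
    fun y => by group
  have h2 := hN _ hq x⁻¹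
  rw [mul_inv_cancel_right] at h2
  simp only [functionalAct]
  rw [h1 y, hN _ hq, h2]
  ring

end MetricFunctionals

/-! ### The metric -/

section MixedDist

open Filter

variable {G : Type*} [Group G]

/-- The maximum of the word metric of `S` and `M` times the pseudometric of the family `F`. -/
noncomputable def mixedDist (S : Set G) (F : Finset (G → ℤ)) (M : ℕ) (x y : G) : ℕ :=
  max (M * familyDist F x y) ((SimpleGraph.mulCayley S).dist x y)

theorem mixedDist_comm (S : Set G) (F : Finset (G → ℤ)) (M : ℕ) (x y : G) :
    mixedDist S F M x y = mixedDist S F M y x := by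
  rw [mixedDist, mixedDist, familyDist_comm, SimpleGraph.dist_comm]

variable {S : Set G} {F : Finset (G → ℤ)} {M : ℕ}

theorem mixedDist_triangle (hS : IsFiniteSymmGenSet S) (x y z : G) :
    mixedDist S F M x z ≤ mixedDist S F M x y + mixedDist S F M y z := by
  refine max_le ?_ ?_
  · calc M * familyDist F x z ≤ M * (familyDist F x y + familyDist F y z) :=
          Nat.mul_le_mul_left _ (familyDist_triangle F x y z)
      _ = M * familyDist F x y + M * familyDist F y z := mul_add _ _ _
      _ ≤ _ := add_le_add (le_max_left _ _) (le_max_left _ _)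
  · exact (mulCayley_connected hS.closure_eq_top).dist_triangle.trans
      (add_le_add (le_max_right _ _) (le_max_right _ _))

theorem isMetric_mixedDist (hS : IsFiniteSymmGenSet S) :
    IsMetric fun x y => (mixedDist S F M x y : ℝ) where
  eq_zero_iff x y := by
    refine ⟨fun h => ?_, ?_⟩
    · rw [Nat.cast_eq_zero] at h
      exact (mulCayley_connected hS.closure_eq_top).dist_eq_zero_iff.1
        (Nat.le_zero.1 (h ▸ le_max_right _ _))
    · rintro rfl
      simp [mixedDist, familyDist_self]
  symm x y := by rw [mixedDist_comm]
  triangle x y z := by exact_mod_cast mixedDist_triangle hS x y z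

theorem IsInvariantFamily.exists_familyDist_le {N : Subgroup G} (hF : IsInvariantFamily N F)
    (hS : IsFiniteSymmGenSet S) :
    ∃ L : ℕ, ∀ x y, familyDist F x y ≤ L * (SimpleGraph.mulCayley S).dist x y :=
  exists_le_mul_mulCayley_dist hS.finite hS.closure_eq_top _ (familyDist_self F)
    (familyDist_comm F) (familyDist_triangle F) hF.familyDist_mul_left

/-- Metric-functionals of `mixedDist` are unbounded. For `x` far away take `y` at distance `R` from
`1` on a geodesic from `1` to `x`. If the word metric realises the distance from `x` to `y`, then
`b_x(y) ≤ -R`. Otherwise some `f ∈ F` does, and `b_x(z)` is at least `-M f(z)` up to a bounded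
error, which is large at a suitable power `z` of `t`. -/
theorem unbounded_of_mem_metricBoundary_mixedDist {N : Subgroup G} (hF : IsInvariantFamily N F)
    (hS : IsFiniteSymmGenSet S) (hM : 1 ≤ M) {t : G} (ht : t ∈ N) (hne : ∀ f ∈ F, f t ≠ 0)
    {h : G → ℝ} (hh : h ∈ metricBoundary (fun x y => (mixedDist S F M x y : ℝ)) 1) :
    ¬ ∃ C : ℝ, ∀ x, |h x| ≤ C := by
  rintro ⟨C, hC⟩
  obtain ⟨L, hL⟩ := hF.exists_familyDist_le hS
  have hconn := mulCayley_connected hS.closure_eq_top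
  set R : ℕ := ⌈C⌉₊ + 2 with hR
  have hCR : C + 2 ≤ R := by rw [hR]; push_cast; linarith [Nat.le_ceil C]
  -- `M L R` bounds `M |f|` on the ball of radius `R`, and `(M L + 1) R` bounds the distance to `1`.
  set k : ℕ := 2 * (M * (L * R)) + 2 * R with hk
  have hball := finite_setOf_mulCayley_dist_le hS.finite hS.closure_eq_top R
  obtain ⟨x, hx, hxK⟩ := exists_notMem_busemann_close hh hball
    (hball.union (Set.toFinite {t ^ k, (t ^ k)⁻¹}))
  have hx' : R < (SimpleGraph.mulCayley S).dist 1 x := not_le.1 hx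
  obtain ⟨y, hy1, hyx⟩ := exists_dist_eq_and_dist_add_eq hconn hx'.le
  have hclose : ∀ z ∈ {y | (SimpleGraph.mulCayley S).dist 1 y ≤ R} ∪ {t ^ k, (t ^ k)⁻¹},
      |(mixedDist S F M x z : ℝ) - mixedDist S F M x 1| < C + 1 := fun z hz => by
    have h1 := abs_lt.1 (hxK z hz)
    have h2 := abs_le.1 (hC z)
    simp only [busemann] at h1
    rw [abs_lt]
    constructor <;> linarith
  have hρ : (SimpleGraph.mulCayley S).dist x 1 = R + (SimpleGraph.mulCayley S).dist x y := by
    rw [SimpleGraph.dist_comm, SimpleGraph.dist_comm (u := x), hyx]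
  rcases le_total (M * familyDist F x y) ((SimpleGraph.mulCayley S).dist x y) with hcase | hcase
  · have hxy : mixedDist S F M x y = (SimpleGraph.mulCayley S).dist x y := max_eq_right hcase
    have hx1 : (SimpleGraph.mulCayley S).dist x 1 ≤ mixedDist S F M x 1 := le_max_right _ _
    have h1 : (R : ℝ) + mixedDist S F M x y ≤ mixedDist S F M x 1 := by
      rw [hxy]
      exact_mod_cast hρ ▸ hx1
    have h2 := (abs_lt.1 (hclose y (Or.inl hy1.le))).1
    linarith
  · have hxy : mixedDist S F M x y = M * familyDist F x y := max_eq_left hcase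
    obtain ⟨f, hf, hfxy⟩ := hF.exists_familyDist_eq x y
    obtain ⟨z, hz, hfz⟩ : ∃ z ∈ ({t ^ k, (t ^ k)⁻¹} : Set G), f z ≤ -k := by
      rcases lt_or_gt_of_ne (hne f hf) with h0 | h0
      · refine ⟨t ^ k, Or.inl rfl, ?_⟩
        rw [hF.map_pow hf ht]
        nlinarith
      · refine ⟨(t ^ k)⁻¹, Or.inr rfl, ?_⟩
        rw [hF.map_inv hf (N.pow_mem ht k), hF.map_pow hf ht]
        nlinarith
    have hyD : M * familyDist F 1 y ≤ M * (L * R) := Nat.mul_le_mul_left _ (hy1 ▸ hL 1 y)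
    have hy1' : mixedDist S F M y 1 ≤ M * (L * R) + R := by
      rw [mixedDist_comm]
      refine max_le (hyD.trans (Nat.le_add_right _ _)) ?_
      rw [hy1]
      exact Nat.le_add_left _ _
    have htri := mixedDist_triangle (F := F) (M := M) hS x y 1
    have hfy : -((M * (L * R) : ℕ) : ℤ) ≤ M * f y := by
      have h1 := sub_le_familyDist hf 1 y
      rw [hF.map_one hf] at h1
      have h2 : (M : ℤ) * (0 - f y) ≤ M * familyDist F 1 y :=
        mul_le_mul_of_nonneg_left h1 (Int.natCast_nonneg M)
      have h3 : ((M * familyDist F 1 y : ℕ) : ℤ) ≤ (M * (L * R) : ℕ) := by exact_mod_cast hyD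
      push_cast at h3 ⊢
      linarith
    have hxz : (M : ℤ) * (f x - f z) ≤ mixedDist S F M x z := by
      have h1 : M * familyDist F x z ≤ mixedDist S F M x z := le_max_left _ _
      have h2 : (M : ℤ) * (f x - f z) ≤ M * familyDist F x z :=
        mul_le_mul_of_nonneg_left (sub_le_familyDist hf x z) (Int.natCast_nonneg M)
      exact h2.trans (by exact_mod_cast h1)
    have hMz : (M : ℤ) * f z ≤ -k := by
      have hM' : (1 : ℤ) ≤ M := by exact_mod_cast hM
      have hk0 : (0 : ℤ) ≤ k := Int.natCast_nonneg k
      nlinarith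
    have hfin : (mixedDist S F M x 1 : ℤ) + R ≤ mixedDist S F M x z := by
      have e1 : (mixedDist S F M x y : ℤ) = M * (f x - f y) := by rw [hxy, ← hfxy]; push_cast; rfl
      have e2 : (mixedDist S F M x 1 : ℤ) ≤ mixedDist S F M x y + mixedDist S F M y 1 := by
        exact_mod_cast htri
      have e3 : (mixedDist S F M y 1 : ℤ) ≤ (M * (L * R) : ℕ) + R := by exact_mod_cast hy1'
      have e4 : (k : ℤ) = 2 * (M * (L * R) : ℕ) + 2 * R := by rw [hk]; push_cast; rfl
      linarith
    have hfin' : (mixedDist S F M x 1 : ℝ) + R ≤ mixedDist S F M x z := by exact_mod_cast hfin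
    have h2 := (abs_lt.1 (hclose z (Or.inr hz))).2
    linarith

theorem isBanachMetric_mixedDist {N : Subgroup G} (hF : IsInvariantFamily N F)
    (hS : IsFiniteSymmGenSet S) (hM : 1 ≤ M) {t : G} (ht : t ∈ N) (hne : ∀ f ∈ F, f t ≠ 0) :
    IsBanachMetric fun x y => (mixedDist S F M x y : ℝ) where
  isMetric := isMetric_mixedDist hS
  integer_valued x y := ⟨_, rfl⟩
  left_invariant x y z := by
    rw [mixedDist, mixedDist, hF.familyDist_mul_left, mulCayley_dist_mul_left hS.closure_eq_top]
  proper r _ := by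
    refine (finite_setOf_mulCayley_dist_le hS.finite hS.closure_eq_top ⌊r⌋₊).subset fun x hx => ?_
    have h1 : mixedDist S F M x 1 ≤ ⌊r⌋₊ := Nat.le_floor hx
    change (SimpleGraph.mulCayley S).dist 1 x ≤ _
    rw [SimpleGraph.dist_comm]
    exact (le_max_right _ _).trans h1
  group_geometry := by
    obtain ⟨L, hL⟩ := hF.exists_familyDist_le hS
    refine ⟨S, hS, id, M * L + 1, by positivity, fun y => ⟨y, ?_⟩, fun x y => ?_⟩
    · simp only [id, cayleyDist, SimpleGraph.dist_self, Nat.cast_zero]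
      positivity
    have h1 : (SimpleGraph.mulCayley S).dist x y ≤ mixedDist S F M x y := le_max_right _ _
    have h2 : mixedDist S F M x y ≤ (M * L + 1) * (SimpleGraph.mulCayley S).dist x y := by
      refine max_le ?_ (Nat.le_mul_of_pos_left _ (Nat.succ_pos _))
      have := Nat.mul_le_mul_left M (hL x y)
      rw [add_mul, mul_assoc]
      omega
    have h1' : ((SimpleGraph.mulCayley S).dist x y : ℝ) ≤ mixedDist S F M x y := by
      exact_mod_cast h1
    have h2' : (mixedDist S F M x y : ℝ) ≤ (M * L + 1) * (SimpleGraph.mulCayley S).dist x y := by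
      exact_mod_cast h2
    have hC : (0 : ℝ) < M * L + 1 := by positivity
    have h0 : (0 : ℝ) ≤ mixedDist S F M x y := Nat.cast_nonneg _
    have h3 : (0 : ℝ) ≤ M * L := by positivity
    refine ⟨?_, ?_⟩
    · have := (inv_mul_le_iff₀ hC).2 h2'
      simp only [id, cayleyDist]
      linarith
    · simp only [id, cayleyDist]
      nlinarith
  unbounded _ hh := unbounded_of_mem_metricBoundary_mixedDist hF hS hM ht hne hh

/-- Far out along the powers of `t`, the pseudometric of the family is realised by the members that
are maximal at `t`. -/
theorem IsInvariantFamily.eventually_familyDist_pow_eq {N : Subgroup G}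
    (hF : IsInvariantFamily N F) {t : G} (ht : t ∈ N) {v : ℤ} {A : Finset (G → ℤ)}
    (hA : A.Nonempty) (hmemA : ∀ f, f ∈ A ↔ f ∈ F ∧ f t = v) (hmax : ∀ f ∈ F, f t ≤ v) (y : G) :
    ∀ᶠ n : ℕ in atTop, (familyDist F (t ^ n) y : ℤ) = n * v - A.inf' hA fun f => f y := by
  set m := A.inf' hA fun f => f y
  have hlarge : ∀ᶠ n : ℕ in atTop, ∀ f ∈ F, m - f y ≤ n := by
    rw [eventually_all_finset]
    intro f _
    filter_upwards [eventually_ge_atTop (m - f y).toNat] with n hn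
    omega
  filter_upwards [hlarge] with n hn
  apply le_antisymm
  · obtain ⟨f, hf, hfD⟩ := hF.exists_familyDist_eq (t ^ n) y
    rw [hfD, hF.map_pow hf ht]
    by_cases hfA : f t = v
    · have : m ≤ f y := Finset.inf'_le (fun f : G → ℤ => f y) ((hmemA f).2 ⟨hf, hfA⟩)
      rw [hfA]
      linarith
    · have h1 : f t ≤ v - 1 := by have := hmax f hf; omega
      have h2 := hn f hf
      nlinarith [mul_le_mul_of_nonneg_left h1 (Int.natCast_nonneg n)]
  · obtain ⟨f, hf, hfm⟩ := Finset.exists_mem_eq_inf' hA fun f : G → ℤ => f y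
    obtain ⟨hfF, hfv⟩ := (hmemA f).1 hf
    have := sub_le_familyDist hfF (t ^ n) y
    rw [hF.map_pow hfF ht, hfv] at this
    change m = f y at hfm
    linarith

/-- The Busemann functions of `mixedDist` along the powers of a generic `t` converge to a function
that is fixed by `N`. -/
theorem IsInvariantFamily.exists_eventually_eq {N : Subgroup G} (hF : IsInvariantFamily N F)
    (hS : IsFiniteSymmGenSet S) {t : G} (ht : t ∈ N)
    (hgen : ∀ f ∈ F, ∀ g ∈ F, f t = g t → ∀ n ∈ N, f n = g n)
    (hM : (SimpleGraph.mulCayley S).dist 1 t < M) :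
    ∃ h : G → ℤ, (∀ n ∈ N, ∀ y, h (n * y) = h n + h y) ∧ (∀ k : ℕ, h (t ^ k) ≤ -k) ∧
      ∀ y, ∀ᶠ n : ℕ in atTop,
        (mixedDist S F M (t ^ n) y : ℤ) - mixedDist S F M (t ^ n) 1 = h y := by
  classical
  obtain ⟨f₀, hf₀, hmax⟩ := F.exists_max_image (fun f => f t) hF.nonempty
  set v := f₀ t
  let A := F.filter fun f => f t = v
  have hmemA : ∀ f, f ∈ A ↔ f ∈ F ∧ f t = v := fun f => Finset.mem_filter
  have hA : A.Nonempty := ⟨f₀, (hmemA _).2 ⟨hf₀, rfl⟩⟩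
  have hv : 1 ≤ v := by
    have h1 : v ≠ 0 := hF.ne_zero_of_generic hgen hf₀
    have h2 := hmax _ (hF.neg_mem f₀ hf₀)
    simp only [Pi.neg_apply] at h2
    omega
  have hAN : ∀ f ∈ A, ∀ n ∈ N, f n = f₀ n := fun f hf =>
    hgen f ((hmemA f).1 hf).1 f₀ hf₀ ((hmemA f).1 hf).2
  let m : G → ℤ := fun y => A.inf' hA fun f => f y
  have hmmul : ∀ n ∈ N, ∀ y, m (n * y) = f₀ n + m y := fun n hn y => by
    have h1 : m (n * y) = A.inf' hA fun f => f₀ n + f y :=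
      Finset.inf'_congr hA rfl fun f hf => by
        rw [hF.map_mul f ((hmemA f).1 hf).1 n hn, hAN f hf n hn]
    rw [h1]
    exact (Finset.apply_inf'_eq_inf'_comp hA (fun z : ℤ => f₀ n + z)
      fun a b => min_add_add_left _ _ _ |>.symm).symm
  have hm1 : m 1 = 0 := by
    have h1 : m 1 = A.inf' hA fun _ => 0 :=
      Finset.inf'_congr hA rfl fun f hf => hF.map_one ((hmemA f).1 hf).1
    rw [h1, Finset.inf'_const]
  have hmN : ∀ n ∈ N, m n = f₀ n := fun n hn => by simpa [hm1] using hmmul n hn 1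
  have hdist : ∀ y, ∀ᶠ n : ℕ in atTop, (mixedDist S F M (t ^ n) y : ℤ) = M * (n * v - m y) := by
    intro y
    set ρ := (SimpleGraph.mulCayley S).dist
    have hconn := mulCayley_connected hS.closure_eq_top
    filter_upwards [hF.eventually_familyDist_pow_eq ht hA hmemA hmax y,
      eventually_ge_atTop (ρ 1 y + (M * m y).toNat)] with n hn hlarge
    have hpow : ρ 1 (t ^ n) ≤ n * ρ 1 t := by
      clear hn hlarge
      induction n with
      | zero => simp [ρ]
      | succ n ih =>
        have h1 : ρ 1 (t ^ (n + 1)) ≤ ρ 1 (t ^ n) + ρ (t ^ n) (t ^ (n + 1)) := hconn.dist_triangle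
        have h2 : ρ (t ^ n) (t ^ (n + 1)) = ρ 1 t := by
          have := mulCayley_dist_mul_left hS.closure_eq_top (t ^ n) 1 t
          rwa [mul_one, ← pow_succ] at this
        rw [h2] at h1
        rw [add_mul, one_mul]
        omega
    have hρ : ρ (t ^ n) y ≤ n * ρ 1 t + ρ 1 y := by
      have h1 : ρ (t ^ n) y ≤ ρ (t ^ n) 1 + ρ 1 y := hconn.dist_triangle
      have h2 : ρ (t ^ n) 1 = ρ 1 (t ^ n) := SimpleGraph.dist_comm
      omega
    have hle : ρ (t ^ n) y ≤ M * familyDist F (t ^ n) y := by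
      zify at hρ hlarge hM ⊢
      rw [hn]
      have h1 : (n : ℤ) * (ρ 1 t + 1) ≤ n * (M * v) := by
        refine mul_le_mul_of_nonneg_left ?_ (Int.natCast_nonneg n)
        have : (M : ℤ) * 1 ≤ M * v := mul_le_mul_of_nonneg_left hv (Int.natCast_nonneg M)
        linarith
      have h2 := Int.self_le_toNat (M * m y)
      change (ρ (t ^ n) y : ℤ) ≤ M * (n * v - m y)
      linarith
    rw [mixedDist, max_eq_left hle, Nat.cast_mul, hn]
  refine ⟨fun y => -(M * m y), fun n hn y => ?_, fun k => ?_, fun y => ?_⟩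
  · simp only [hmmul n hn y, hmN n hn]
    ring
  · beta_reduce
    rw [hmN _ (N.pow_mem ht k), hF.map_pow hf₀ ht]
    have hM' : (1 : ℤ) ≤ M := by exact_mod_cast Nat.one_le_of_lt hM
    have h1 : (1 : ℤ) ≤ M * v := one_le_mul_of_one_le_of_one_le hM' hv
    have h2 := mul_le_mul_of_nonneg_left h1 (Int.natCast_nonneg k)
    change -((M : ℤ) * (k * v)) ≤ -k
    linarith
  · filter_upwards [hdist y, hdist 1] with n h1 h2
    rw [h1, h2, hm1]
    ring

end MixedDist

theorem corollary2p6 {G : Type*} [Group G] [Group.FG G] [Infinite G]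
    (hG : IsVirtuallyNilpotent G) :
    ∃ d : G → G → ℝ, IsBanachMetric d ∧
      ∃ h ∈ metricBoundary d 1, (functionalOrbit h).Finite := by
  obtain ⟨N, _, _, φ, hφ⟩ := exists_normal_hom_int_ne_one hG
  obtain ⟨F, hF⟩ := exists_isInvariantFamily N φ hφ
  obtain ⟨S, hS⟩ := exists_isFiniteSymmGenSet G
  obtain ⟨t, ht, hgen⟩ := hF.exists_generic
  -- The factor makes `t ^ n` farther from `1` for the family than for the word metric.
  set M : ℕ := (SimpleGraph.mulCayley S).dist 1 t + 1 with hM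
  obtain ⟨h, hmul, hunb, hlim⟩ := hF.exists_eventually_eq hS ht hgen (M := M) (by omega)
  refine ⟨fun x y => (mixedDist S F M x y : ℝ),
    isBanachMetric_mixedDist hF hS (by omega) ht fun f hf => hF.ne_zero_of_generic hgen hf,
    fun y => (h y : ℝ), ?_, ?_⟩
  · refine mem_metricBoundary_of_eventually_eq (isMetric_mixedDist hS)
      (fun _ _ => Nat.cast_nonneg _) (u := fun n => t ^ n) (fun y => ?_) fun C => ?_
    · filter_upwards [hlim y] with n hn
      rw [← hn]
      simp [busemann]
    · obtain ⟨k, hk⟩ := exists_nat_gt (-C)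
      refine ⟨t ^ k, ?_⟩
      have : (h (t ^ k) : ℝ) ≤ -k := by exact_mod_cast hunb k
      linarith
  · refine finite_functionalOrbit N fun n hn y => ?_
    rw [hmul n hn y, Int.cast_add]
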